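/- Let $G=(V,E)$ be a finite simple graph with at least one vertex, and let $k>0$ be an integer. An *oriented (vertex) separation* of $G$ is a pair $(A,B)$ with $A\cup B=V$ such that $G$ has no edge between $A\smallsetminus B$ and $B\smallsetminus A$; its *inverse* is $(A,B)^*=(B,A)$, its *order* is $|A\cap B|$, and $(A,B)\le(C,D)$ means $A\subseteq C$ and $B\supseteq D$. Let $\vec S_k$ be the set of oriented separations of order less than $k$, and $S_k$ the set of the unoriented separations $\{s,s^*\}$ with $s\in\vec S_k$. A *star* is a non-empty set $\sigma$ of oriented separations such that $r\le s^*$ for all distinct $r,s\in\sigma$. Let $\mathcal F_k$ be the set of all stars $\sigma\subseteq\vec S_k$ with $\bigl|\bigcap_{(A,B)\in\sigma}B\bigr|<k$. An *$\mathcal F_k$-tangle of $S_k$* is a set $O\subseteq\vec S_k$ such that (a) $O$ contains exactly one element of $\{s,s^*\}$ for every $s\in\vec S_k$; (b) there are no $r,s\in\vec S_k$ with $\{r,r^*\}\ne\{s,s^*\}$, $r<s$ and $r^*,s\in O$; (c) no subset of $O$ lies in $\mathcal F_k$. An *$S_k$-tree over $\mathcal F_k$* is a finite tree $T$ with at least one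 edge together with a map $\alpha$ from the set of oriented edges $(x,y)$ of $T$ (with $xy\in E(T)$) to $\vec S_k$ such that $\alpha(y,x)=\alpha(x,y)^*$ for every edge $xy$ and $\{\alpha(x,t): xt\in E(T)\}\in\mathcal F_k$ for every node $t$ of $T$. A *bramble* in $G$ is a set of non-empty connected vertex sets any two of which touch, i.e. share a vertex or are joined by an edge of $G$; its *order* is the least size of a set of vertices meeting all its elements. A *tree-decomposition* of $G$ is a finite tree $T$ with a family $(V_t)_{t\in T}$ of subsets of $V$ such that every vertex and both ends of every edge of $G$ lie in some $V_t$, and $V_{t_1}\cap V_{t_3}\subseteq V_{t_2}$ whenever $t_2$ lies on the path from $t_1$ to $t_3$ in $T$. Its *width* is $\max_t|V_t|-1$, and the *tree-width* of $G$ is the least width of its tree-decompositions. **Theorem.** The following assertions are equivalent: 1. $G$ has a bramble of order at least $k$. 2. $G$ has an $\mathcal F_k$-tangle of $S_k$. 3. $G$ has no $S_k$-tree over $\mathcal F_k$. 4. $G$ has tree-width at least $k-1$. -/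

import Mathlib

namespace TangleDuality

/-! ### Abstract separation systems -/

/-- A separation system: a partially ordered set with an order-reversing involution. -/
class SeparationSystem (U : Type*) extends PartialOrder U where
  /-- the inverse of an oriented separation -/
  inv : U → U
  inv_inv : ∀ s, inv (inv s) = s
  inv_le_inv_iff : ∀ r s, inv r ≤ inv s ↔ s ≤ r

section Abstract

open SeparationSystem

variable {U : Type*} [SeparationSystem U]

/- In what follows a set `S : Set U` that is closed under inverses is a set of oriented separations,
with the induced order and involution; the unoriented separation of `s` is `{s, inv s}`. -/

/-- `O` is an orientation of `S`: a subset of `S` that contains exactly one element of `{s, inv s}`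
for every `s ∈ S`. -/
def IsOrientation (S O : Set U) : Prop :=
  O ⊆ S ∧ ∀ s ∈ S, ∃! x, x ∈ ({s, inv s} : Set U) ∧ x ∈ O

/-- `O` is consistent in `S`: there are no two distinct separations `{r, inv r} ≠ {s, inv s}` in `S`
with `r < s` and `inv r, s ∈ O`. -/
def IsConsistent (S O : Set U) : Prop :=
  ∀ r ∈ S, ∀ s ∈ S, ({r, inv r} : Set U) ≠ {s, inv s} → r < s → ¬ (inv r ∈ O ∧ s ∈ O)

/-- A star of separations: a nonempty set of oriented separations pointing towards each other. -/
def IsStar (σ : Set U) : Prop :=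
  σ.Nonempty ∧ ∀ r ∈ σ, ∀ s ∈ σ, r ≠ s → r ≤ inv s

/-- `O` is an `F`-tangle of `S`: a consistent orientation of `S` with no subset in `F`. -/
def IsTangle (S : Set U) (F : Set (Set U)) (O : Set U) : Prop :=
  IsOrientation S O ∧ IsConsistent S O ∧ ∀ σ ⊆ O, σ ∉ F

/-- An `S`-tree on the graph `T`: `T` is a tree with at least one edge, and `α` maps the
oriented edges of `T` to `S`, commuting with inversion. -/
structure SepTree (S : Set U) {N : Type*} (T : SimpleGraph N) where
  isTree : T.IsTree
  exists_edge : ∃ x y, T.Adj x y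
  /-- the oriented separation of an oriented edge -/
  α : T.Dart → U
  mem : ∀ e, α e ∈ S
  map_symm : ∀ e : T.Dart, α e.symm = inv (α e)

/-- An `S`-tree is over `F` if for every node `t` the image of the set of edges oriented towards `t`
belongs to `F`. -/
def SepTree.IsOver {S : Set U} {N : Type*} {T : SimpleGraph N} (τ : SepTree S T)
    (F : Set (Set U)) : Prop :=
  ∀ t : N, τ.α '' {e : T.Dart | e.snd = t} ∈ F

/-- There is a (finite) `S`-tree over `F`. -/
def HasSepTreeOver (S : Set U) (F : Set (Set U)) : Prop :=
  ∃ (N : Type) (_ : Fintype N) (T : SimpleGraph N) (τ : SepTree S T), τ.IsOver F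

end Abstract

section Graph

variable {V : Type*}

/-! ### Vertex separations of a graph -/

/-- An oriented vertex separation `(A, B)` of `G`: `A ∪ B = V`, and `G` has no edge between
`A \ B` and `B \ A`. -/
@[ext]
structure VertexSep (G : SimpleGraph V) where
  /-- the first side -/
  A : Set V
  /-- the second side, to which the separation points -/
  B : Set V
  union_eq : A ∪ B = Set.univ
  not_adj : ∀ a ∈ A \ B, ∀ b ∈ B \ A, ¬ G.Adj a b

/-- The order is `(A, B) ≤ (C, D) ↔ A ⊆ C ∧ D ⊆ B`, and the inverse of `(A, B)` is `(B, A)`. -/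
instance (G : SimpleGraph V) : SeparationSystem (VertexSep G) where
  le s t := s.A ⊆ t.A ∧ t.B ⊆ s.B
  le_refl _ := ⟨subset_rfl, subset_rfl⟩
  le_trans _ _ _ h₁ h₂ := ⟨h₁.1.trans h₂.1, h₂.2.trans h₁.2⟩
  le_antisymm _ _ h₁ h₂ :=
    VertexSep.ext (Set.Subset.antisymm h₁.1 h₂.1) (Set.Subset.antisymm h₂.2 h₁.2)
  inv s := ⟨s.B, s.A, by rw [Set.union_comm]; exact s.union_eq,
    fun a ha b hb hab => s.not_adj b hb a ha hab.symm⟩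
  inv_inv _ := rfl
  inv_le_inv_iff _ _ := And.comm

/-- The order `|A ∩ B|` of a vertex separation (of a finite graph). -/
noncomputable def VertexSep.order {G : SimpleGraph V} (s : VertexSep G) : ℕ :=
  (s.A ∩ s.B).ncard

/-- The set `S_k` of the oriented vertex separations of `G` of order less than `k`. -/
def sepsLT (G : SimpleGraph V) (k : ℕ) : Set (VertexSep G) :=
  {s | s.order < k}

/-- The set `F_k` of the stars in `S_k` whose second sides have fewer than `k` common vertices. -/
def forbiddenStars (G : SimpleGraph V) (k : ℕ) : Set (Set (VertexSep G)) :=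
  {σ | σ ⊆ sepsLT G k ∧ IsStar σ ∧ (⋂ s ∈ σ, s.B).ncard < k}

/-! ### Brambles -/

/-- Two vertex sets touch if they share a vertex or there is an edge between them. -/
def Touch (G : SimpleGraph V) (C D : Set V) : Prop :=
  (C ∩ D).Nonempty ∨ ∃ c ∈ C, ∃ d ∈ D, G.Adj c d

/-- A bramble: a set of mutually touching (nonempty) connected vertex sets. -/
def IsBramble (G : SimpleGraph V) (ℬ : Set (Set V)) : Prop :=
  (∀ C ∈ ℬ, (G.induce C).Connected) ∧ ∀ C ∈ ℬ, ∀ D ∈ ℬ, Touch G C D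

/-- `X` covers `ℬ` if it meets every element of `ℬ`. -/
def Covers (X : Set V) (ℬ : Set (Set V)) : Prop :=
  ∀ C ∈ ℬ, (X ∩ C).Nonempty

/-- The order of a bramble (of a finite graph): the least size of a vertex set covering it. -/
noncomputable def brambleOrder (ℬ : Set (Set V)) : ℕ :=
  sInf {n | ∃ X : Set V, Covers X ℬ ∧ X.ncard = n}

/-- The whole vertex set covers every bramble, so the minimum in `brambleOrder` is over a
nonempty set. -/
theorem IsBramble.covers_univ {G : SimpleGraph V} {ℬ : Set (Set V)} (h : IsBramble G ℬ) :
    Covers Set.univ ℬ := by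
  intro C hC
  obtain ⟨v⟩ := (h.1 C hC).nonempty
  exact ⟨v.1, trivial, v.2⟩

/-! ### Tree-decompositions -/

/-- A tree-decomposition of `G` with decomposition tree `T`. -/
structure TreeDecomposition (G : SimpleGraph V) {N : Type*} (T : SimpleGraph N) where
  isTree : T.IsTree
  /-- the parts -/
  bag : N → Set V
  exists_mem_bag : ∀ v : V, ∃ t, v ∈ bag t
  exists_edge_bag : ∀ u v : V, G.Adj u v → ∃ t, u ∈ bag t ∧ v ∈ bag t
  inter_subset : ∀ (t₁ t₂ t₃ : N) (p : T.Walk t₁ t₃), p.IsPath → t₂ ∈ p.support →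
    bag t₁ ∩ bag t₃ ⊆ bag t₂

/-- The width: the largest size of a part, minus one. -/
noncomputable def TreeDecomposition.width {G : SimpleGraph V} {N : Type*} [Fintype N]
    {T : SimpleGraph N} (D : TreeDecomposition G T) : ℤ :=
  ((Finset.univ.sup fun t => (D.bag t).ncard : ℕ) : ℤ) - 1

/-- The tree-width of a finite graph: the least width of its (finite) tree-decompositions. -/
noncomputable def treeWidth (G : SimpleGraph V) : ℤ :=
  sInf {w | ∃ (N : Type) (_ : Fintype N) (T : SimpleGraph N) (D : TreeDecomposition G T),
    D.width = w}

/-- The set of widths is bounded below. -/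
theorem bddBelow_widths (G : SimpleGraph V) :
    BddBelow {w | ∃ (N : Type) (_ : Fintype N) (T : SimpleGraph N) (D : TreeDecomposition G T),
      D.width = w} := by
  refine ⟨-1, ?_⟩
  rintro w ⟨N, _, T, D, rfl⟩
  simp only [TreeDecomposition.width]
  omega

/-- Every graph has a tree-decomposition with a single part. -/
theorem nonempty_widths (G : SimpleGraph V) :
    {w | ∃ (N : Type) (_ : Fintype N) (T : SimpleGraph N) (D : TreeDecomposition G T),
      D.width = w}.Nonempty :=
  ⟨_, Unit, inferInstance, ⊥,
    { isTree := SimpleGraph.IsTree.of_subsingleton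
      bag := fun _ => Set.univ
      exists_mem_bag := fun _ => ⟨(), trivial⟩
      exists_edge_bag := fun _ _ _ => ⟨(), trivial, trivial⟩
      inter_subset := fun _ _ _ _ _ _ _ _ => trivial }, rfl⟩

end Graph

end TangleDuality

/-! The proof is the cycle 1 → 2 → 3 → 4 → 1. Three implications are direct. A bramble of order at
least `k` orients each separation of order below `k` towards a bramble set missing its separator. A
tangle excludes an `S_k`-tree because a tree has more nodes than edges. A tree-decomposition into
parts of size below `k` becomes an `S_k`-tree through the separations its edges induce.

For 4 → 1, `Decomp k P u` says that the first side of `u` is cut up by a tree of stars with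
interiors smaller than `k` and with leaves in `P`. If the small separations decompose both sides of
one separation, gluing gives a tree-decomposition of width below `k - 1`. Otherwise they extend to a
maximal flap set `Q` that decomposes no separation.

Such a `Q` orients every separation (`IsFlapSet.mem_or_inv_mem`). If it missed `s` and its inverse,
adding a minimal missing separation on either side would create a decomposition. Rerooting these two
decompositions (`IsDecomposing.reroot`) and shifting both to a separation of least order between the
added ones (`Decomp.shift`) joins them over `Q`, a contradiction. The connected sets towards which
`Q` points then form a bramble. A cover of fewer than `k` vertices would give, via the components it
leaves, a star in `Q` with small interior. -/

namespace TangleDuality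

open SeparationSystem

/-! ### Submodularity, shifting of decompositions, and maximal flap sets -/

section Uncrossing

variable {V : Type*} {G : SimpleGraph V}

namespace VertexSep

@[simp] theorem inv_A (s : VertexSep G) : (inv s).A = s.B := rfl

@[simp] theorem inv_B (s : VertexSep G) : (inv s).B = s.A := rfl

@[simp] theorem order_inv (s : VertexSep G) : (inv s).order = s.order := by
  simp [order, Set.inter_comm]

theorem le_inv_comm {s t : VertexSep G} : s ≤ inv t ↔ t ≤ inv s := And.comm

theorem mem_B_of_notMem_A (s : VertexSep G) {v : V} (h : v ∉ s.A) : v ∈ s.B :=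
  (s.union_eq.symm ▸ Set.mem_univ v : v ∈ s.A ∪ s.B).resolve_left h

theorem mem_A_of_notMem_B (s : VertexSep G) {v : V} (h : v ∉ s.B) : v ∈ s.A :=
  (s.union_eq.symm ▸ Set.mem_univ v : v ∈ s.A ∪ s.B).resolve_right h

instance [Finite V] : Finite (VertexSep G) :=
  Finite.of_injective (fun s : VertexSep G => (s.A, s.B)) fun _ _ h =>
    VertexSep.ext (congrArg Prod.fst h) (congrArg Prod.snd h)

/-- The infimum of `u` and the inverse of `x`. -/
def cap (u x : VertexSep G) : VertexSep G where
  A := u.A ∩ x.B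
  B := u.B ∪ x.A
  union_eq := by
    refine Set.eq_univ_of_forall fun v => ?_
    by_cases h₁ : v ∈ u.B
    · exact .inr (.inl h₁)
    by_cases h₂ : v ∈ x.A
    · exact .inr (.inr h₂)
    exact .inl ⟨u.mem_A_of_notMem_B h₁, x.mem_B_of_notMem_A h₂⟩
  not_adj := by
    rintro a ⟨⟨ha₁, ha₂⟩, ha₃⟩ b ⟨-, hb₂⟩ hab
    have ha₄ : a ∉ u.B := fun h => ha₃ (.inl h)
    have ha₅ : a ∉ x.A := fun h => ha₃ (.inr h)
    by_cases h : b ∈ u.A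
    · have h' : b ∉ x.B := fun h' => hb₂ ⟨h, h'⟩
      exact x.not_adj b ⟨x.mem_A_of_notMem_B h', h'⟩ a ⟨ha₂, ha₅⟩ hab.symm
    · exact u.not_adj a ⟨ha₁, ha₄⟩ b ⟨u.mem_B_of_notMem_A h, h⟩ hab

theorem cap_le (u x : VertexSep G) : cap u x ≤ u :=
  ⟨Set.inter_subset_left, Set.subset_union_left⟩

theorem cap_mono {r u : VertexSep G} (x : VertexSep G) (h : r ≤ u) : cap r x ≤ cap u x :=
  ⟨Set.inter_subset_inter_left _ h.1, Set.union_subset_union_left _ h.2⟩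

theorem cap_le_inv_cap {r u : VertexSep G} (x : VertexSep G) (h : r ≤ inv u) :
    cap r x ≤ inv (cap u x) :=
  ⟨fun _ hv => .inl (h.1 hv.1), fun _ hv => .inl (h.2 hv.1)⟩

theorem cap_inv_of_le {s x : VertexSep G} (h : s ≤ x) : cap (inv s) x = inv x :=
  VertexSep.ext (Set.inter_eq_right.2 h.2) (Set.union_eq_right.2 h.1)

/-- The order of vertex separations is submodular. -/
theorem order_cap_add_order_cap_le [Finite V] (w x : VertexSep G) :
    (cap w x).order + (cap (inv w) (inv x)).order ≤ w.order + x.order := by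
  unfold order
  rw [← Set.ncard_union_add_ncard_inter, ← Set.ncard_union_add_ncard_inter (w.A ∩ w.B)]
  refine add_le_add (Set.ncard_le_ncard ?_ (Set.toFinite _))
    (Set.ncard_le_ncard ?_ (Set.toFinite _)) <;>
  · intro v
    simp only [cap, inv_A, inv_B, Set.mem_union, Set.mem_inter_iff]
    tauto

/-- The opposite corner `cap (inv w) (inv x)` lies between `s` and `x`, so its order is at least
that of `x`; submodularity passes the saving to `cap w x`. -/
theorem order_cap_le [Finite V] {s x : VertexSep G} (hsx : s ≤ x)
    (hmin : ∀ w, s ≤ w → w ≤ x → x.order ≤ w.order) (w : VertexSep G) (hw : s ≤ inv w) :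
    (cap w x).order ≤ w.order := by
  have h₁ := order_cap_add_order_cap_le w x
  have h₂ := hmin (cap (inv w) (inv x)) ⟨Set.subset_inter hw.1 hsx.1, Set.union_subset hw.2 hsx.2⟩
    ⟨Set.inter_subset_right, Set.subset_union_right⟩
  omega

/-- Given a set `R` of separations below `u`, the separation whose sides are that of `u` and the
intersection of the second sides of the elements of `R`. -/
def ofStar (u : VertexSep G) (R : Set (VertexSep G)) (hR : ∀ r ∈ R, r ≤ u) : VertexSep G where
  A := u.A
  B := ⋂ r ∈ R, r.B
  union_eq := by
    refine Set.eq_univ_of_forall fun v => ?_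
    by_cases h : v ∈ u.A
    · exact .inl h
    · exact .inr (Set.mem_iInter₂.2 fun r hr => (hR r hr).2 (u.mem_B_of_notMem_A h))
  not_adj := by
    rintro a ⟨-, ha⟩ b ⟨hb, hb'⟩ hab
    simp only [Set.mem_iInter, not_forall] at ha hb
    obtain ⟨r, hr, har⟩ := ha
    exact r.not_adj a ⟨r.mem_A_of_notMem_B har, har⟩ b
      ⟨hb r hr, fun h => hb' ((hR r hr).1 h)⟩ hab

end VertexSep

open VertexSep

/-- The separations whose first side can be decomposed by stars with small interior into first
sides of elements of `P`. -/
inductive Decomp (k : ℕ) (P : Set (VertexSep G)) : VertexSep G → Prop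
  | base {u : VertexSep G} (hu : u ∈ P) : Decomp k P u
  | step {u : VertexSep G} (R : Set (VertexSep G)) (hR : ∀ r ∈ R, Decomp k P r)
      (hle : ∀ r ∈ R, r ≤ u) (hstar : ∀ r ∈ R, ∀ s ∈ R, r ≠ s → r ≤ inv s)
      (hcard : (u.A ∩ ⋂ r ∈ R, r.B).ncard < k) : Decomp k P u

/-- `P` decomposes both sides of some separation. -/
def IsDecomposing (k : ℕ) (P : Set (VertexSep G)) : Prop :=
  ∃ r : VertexSep G, Decomp k P r ∧ Decomp k P (inv r)

/-- A set of separations of order less than `k` that is closed downwards in `sepsLT G k` and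
contains the small separations. -/
structure IsFlapSet (k : ℕ) (P : Set (VertexSep G)) : Prop where
  subset : P ⊆ sepsLT G k
  lower : ∀ p ∈ P, ∀ q ∈ sepsLT G k, q ≤ p → q ∈ P
  small : ∀ u ∈ sepsLT G k, u ≤ inv u → u ∈ P

/-- Either no leaf `s` is needed, or the tree can be rerooted at such a leaf. A star `R` below `u`
is really the star `R ∪ {inv u}`, in which any `r ∈ R` may take over the role of the root without
changing the interior. -/
theorem Decomp.reroot_aux {k : ℕ} {P : Set (VertexSep G)} {s u : VertexSep G}
    (h : Decomp k (insert s P) u) :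
    Decomp k P u ∨ (Decomp k (insert s P) (inv u) → Decomp k (insert s P) (inv s)) := by
  induction h with
  | base hu =>
    rcases hu with rfl | hu
    · exact .inr id
    · exact .inl (.base hu)
  | @step u R hR hle hstar hcard ih =>
    by_cases hall : ∀ r ∈ R, Decomp k P r
    · exact .inl (.step R hall hle hstar hcard)
    push Not at hall
    obtain ⟨r, hr, hrP⟩ := hall
    refine .inr fun hu => (ih r hr).resolve_left hrP ?_
    refine .step (insert (inv u) (R \ {r})) ?_ ?_ ?_ ?_
    · rintro t (rfl | ht)
      · exact hu
      · exact hR t ht.1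
    · rintro t (rfl | ht)
      · exact (inv_le_inv_iff _ _).2 (hle r hr)
      · exact hstar t ht.1 r hr ht.2
    · rintro t (rfl | ht) t' (rfl | ht') hne
      · exact absurd rfl hne
      · exact (inv_le_inv_iff _ _).2 (hle t' ht'.1)
      · exact hle t ht.1
      · exact hstar t ht.1 t' ht'.1 hne
    · convert hcard using 2
      ext v
      simp only [inv_A, Set.mem_inter_iff, Set.mem_iInter, Set.mem_insert_iff, Set.mem_sdiff,
        Set.mem_singleton_iff, forall_eq_or_imp, inv_B]
      constructor
      · rintro ⟨h₁, h₂, h₃⟩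
        refine ⟨h₂, fun t ht => ?_⟩
        by_cases htr : t = r
        · exact htr ▸ h₁
        · exact h₃ t ⟨ht, htr⟩
      · rintro ⟨h₁, h₂⟩
        exact ⟨h₂ r hr, h₁, fun t ht => h₂ t ht.1⟩

theorem IsDecomposing.reroot {k : ℕ} {P : Set (VertexSep G)} {s : VertexSep G}
    (h : IsDecomposing k (insert s P)) (hP : ¬ IsDecomposing k P) :
    Decomp k (insert s P) (inv s) := by
  obtain ⟨r, hr, hr'⟩ := h
  rcases hr.reroot_aux with h₁ | h₁
  · rcases hr'.reroot_aux with h₂ | h₂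
    · exact absurd ⟨r, h₁, h₂⟩ hP
    · exact h₂ hr
  · exact h₁ hr'

/-- Capping every separation of the tree with `x` keeps stars as stars, and the minimality of `x`
keeps orders and interiors from growing. The leaf `s` is no longer needed afterwards. -/
theorem Decomp.shift [Finite V] {k : ℕ} {P : Set (VertexSep G)} (hP : IsFlapSet k P)
    {s x u : VertexSep G} (hs : s ∈ sepsLT G k) (hsx : s ≤ x)
    (hmin : ∀ w, s ≤ w → w ≤ x → x.order ≤ w.order)
    (h : Decomp k (insert s P) u) (hu : s ≤ inv u) : Decomp k P (cap u x) := by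
  induction h with
  | @base u hmem =>
    -- A leaf equal to `s` satisfies `s ≤ inv s` here, so it is small and lies in `P` anyway.
    have hmem : u ∈ P := by
      rcases hmem with rfl | hmem
      · exact hP.small _ hs hu
      · exact hmem
    refine .base (hP.lower u hmem _ ?_ (cap_le u x))
    exact (order_cap_le hsx hmin u hu).trans_lt (hP.subset hmem)
  | @step u R hR hle hstar hcard ih =>
    refine .step ((cap · x) '' R) ?_ ?_ ?_ ?_
    · rintro _ ⟨r, hr, rfl⟩
      exact ih r hr (hu.trans ((inv_le_inv_iff _ _).2 (hle r hr)))
    · rintro _ ⟨r, hr, rfl⟩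
      exact cap_mono x (hle r hr)
    · rintro _ ⟨r, hr, rfl⟩ _ ⟨r', hr', rfl⟩ hne
      exact cap_le_inv_cap x (hstar r hr r' hr' fun h => hne (h ▸ rfl))
    -- The interior of the star is the separator of `ofStar u R hle`, so the bound on orders also
    -- bounds the shifted interior.
    · refine lt_of_eq_of_lt ?_ ((order_cap_le hsx hmin (ofStar u R hle) ?_).trans_lt hcard)
      · simp only [order, cap, ofStar, Set.biInter_image, Set.iInter₂_union]
      · exact ⟨hu.1.trans (Set.subset_iInter₂ fun r hr => (hle r hr).2), hu.2⟩

theorem exists_order_minimal [Finite V] {s t : VertexSep G} (h : s ≤ t) :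
    ∃ x, s ≤ x ∧ x ≤ t ∧ ∀ w, s ≤ w → w ≤ t → x.order ≤ w.order := by
  obtain ⟨x, hx, hmin⟩ := Set.exists_min_image (Set.Icc s t) order (Set.toFinite _) ⟨s, le_rfl, h⟩
  exact ⟨x, hx.1, hx.2, fun w h₁ h₂ => hmin w ⟨h₁, h₂⟩⟩

theorem IsFlapSet.insert_minimal {k : ℕ} {P : Set (VertexSep G)} (hP : IsFlapSet k P)
    {s : VertexSep G} (hs : s ∈ sepsLT G k) (hmin : ∀ q ∈ sepsLT G k, q ∉ P → q ≤ s → q = s) :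
    IsFlapSet k (insert s P) where
  subset := Set.insert_subset hs hP.subset
  lower := by
    rintro p (rfl | hp) q hq hqp
    · by_cases h : q ∈ P
      · exact .inr h
      · exact .inl (hmin q hq h hqp)
    · exact .inr (hP.lower p hp q hq hqp)
  small u hu h := .inr (hP.small u hu h)

theorem exists_minimal_notMem_le [Finite V] {k : ℕ} {P : Set (VertexSep G)}
    {s : VertexSep G} (hs : s ∈ sepsLT G k) (hsP : s ∉ P) :
    ∃ s' ≤ s, s' ∈ sepsLT G k ∧ s' ∉ P ∧ ∀ q ∈ sepsLT G k, q ∉ P → q ≤ s' → q = s' := by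
  obtain ⟨s', hle, hmin⟩ :=
    (Set.toFinite {q : VertexSep G | q ∈ sepsLT G k ∧ q ∉ P}).exists_le_minimal ⟨hs, hsP⟩
  exact ⟨s', hle, hmin.prop.1, hmin.prop.2, fun q h₁ h₂ h₃ => hmin.eq_of_le ⟨h₁, h₂⟩ h₃⟩

/-- A maximal flap set that decomposes no separation orients every separation. -/
theorem IsFlapSet.mem_or_inv_mem [Finite V] {k : ℕ} {P : Set (VertexSep G)}
    (hP : IsFlapSet k P) (hdec : ¬ IsDecomposing k P)
    (hmax : ∀ Q, IsFlapSet k Q → P ⊆ Q → ¬ IsDecomposing k Q → Q ⊆ P)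
    {s : VertexSep G} (hs : s ∈ sepsLT G k) : s ∈ P ∨ inv s ∈ P := by
  by_contra! hcon
  have hinv : ∀ {q : VertexSep G}, q ∈ sepsLT G k → inv q ∈ sepsLT G k := fun h =>
    (order_inv _).trans_lt h
  have key : ∀ {q : VertexSep G}, q ∈ sepsLT G k → q ∉ P →
      (∀ p ∈ sepsLT G k, p ∉ P → p ≤ q → p = q) → Decomp k (insert q P) (inv q) := by
    intro q hq hqP hqmin
    -- By maximality of `P`, the larger flap set `insert q P` must decompose some separation.
    refine IsDecomposing.reroot (by_contra fun h => hqP ?_) hdec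
    exact hmax _ (hP.insert_minimal hq hqmin) (Set.subset_insert _ _) h (Set.mem_insert _ _)
  obtain ⟨s₁, hle₁, hs₁, hs₁P, hmin₁⟩ := exists_minimal_notMem_le hs hcon.1
  have hs₁P' : inv s₁ ∉ P := fun h =>
    hcon.2 (hP.lower _ h _ (hinv hs) ((inv_le_inv_iff _ _).2 hle₁))
  obtain ⟨s₂, hle₂, hs₂, hs₂P, hmin₂⟩ := exists_minimal_notMem_le (hinv hs₁) hs₁P'
  -- As `x` has least order between `s₁` and `inv s₂`, it serves for the shift from `s₁`, and its
  -- inverse for the shift from `s₂`. The results decompose the two sides of `x`.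
  obtain ⟨x, hx₁, hx₂, hx⟩ := exists_order_minimal (le_inv_comm.1 hle₂)
  refine hdec ⟨x, ?_, ?_⟩
  · have hx₂' : s₂ ≤ inv x := le_inv_comm.1 hx₂
    have := (key hs₂ hs₂P hmin₂).shift hP hs₂ hx₂' (fun w h₁ h₂ => ?_) le_rfl
    · rwa [cap_inv_of_le hx₂', SeparationSystem.inv_inv] at this
    · have := hx (inv w) (hx₁.trans (le_inv_comm.1 h₂)) ((inv_le_inv_iff _ _).2 h₁)
      simpa using this
  · have := (key hs₁ hs₁P hmin₁).shift hP hs₁ hx₁ (fun w h₁ h₂ => hx w h₁ (h₂.trans hx₂)) le_rfl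
    rwa [cap_inv_of_le hx₁] at this

theorem IsFlapSet.exists_maximal [Finite V] {k : ℕ} {P : Set (VertexSep G)}
    (hP : IsFlapSet k P) (hdec : ¬ IsDecomposing k P) :
    ∃ Q, IsFlapSet k Q ∧ ¬ IsDecomposing k Q ∧ ∀ s ∈ sepsLT G k, s ∈ Q ∨ inv s ∈ Q := by
  obtain ⟨Q, -, hQ⟩ :=
    (Set.toFinite {Q : Set (VertexSep G) | IsFlapSet k Q ∧ ¬ IsDecomposing k Q}).exists_le_maximal
      ⟨hP, hdec⟩
  exact ⟨Q, hQ.prop.1, hQ.prop.2, fun s hs => hQ.prop.1.mem_or_inv_mem hQ.prop.2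
    (fun R h₁ h₂ h₃ => hQ.le_of_ge ⟨h₁, h₃⟩ h₂) hs⟩

theorem IsDecomposing.of_star {k : ℕ} (hk : 0 < k) {P R : Set (VertexSep G)} (hR : R ⊆ P)
    (hstar : ∀ r ∈ R, ∀ s ∈ R, r ≠ s → r ≤ inv s) (hcard : (⋂ r ∈ R, r.B).ncard < k) :
    IsDecomposing k P := by
  -- The star decomposes the side `V` of the separation `(V, ∅)`; the empty star decomposes the side
  -- `∅`, with interior of size `0 < k`.
  refine ⟨⟨Set.univ, ∅, Set.union_empty _, by simp⟩, ?_, ?_⟩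
  · exact .step R (fun r hr => .base (hR hr)) (fun r _ => ⟨Set.subset_univ _, Set.empty_subset _⟩)
      hstar (by simpa using hcard)
  · exact .step ∅ (by simp) (by simp) (by simp) (by simpa using hk)

/-! ### The bramble of a maximal flap set -/

/-- The separation of a vertex set together with its neighbours from its complement. -/
def awaySep (G : SimpleGraph V) (C : Set V) : VertexSep G where
  A := Cᶜ
  B := C ∪ {w | ∃ c ∈ C, G.Adj c w}
  union_eq := by
    rw [← Set.union_assoc, Set.compl_union_self, Set.univ_union]
  not_adj := by
    rintro a ⟨-, ha⟩ b ⟨-, hb⟩ hab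
    exact ha (.inr ⟨b, not_not.1 hb, hab.symm⟩)

theorem inv_awaySep_le_awaySep {C D : Set V} (h : ¬ Touch G C D) :
    inv (awaySep G D) ≤ awaySep G C := by
  simp only [Touch, not_or, not_exists, not_and, Set.not_nonempty_iff_eq_empty] at h
  have hd : ∀ v ∈ C, v ∉ D := fun v h₁ h₂ => (Set.ext_iff.1 h.1 v).1 ⟨h₁, h₂⟩
  constructor
  · rintro v (hv | ⟨d, hd', hdv⟩) hvC
    · exact hd v hvC hv
    · exact h.2 v hvC d hd' hdv.symm
  · rintro v (hv | ⟨c, hc, hcv⟩) hvD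
    · exact hd v hv hvD
    · exact h.2 c hc v hvD hcv

theorem isBramble_of_flapSet {k : ℕ} {P : Set (VertexSep G)} (hP : IsFlapSet k P)
    (hdec : ¬ IsDecomposing k P) :
    IsBramble G {C | (G.induce C).Connected ∧ awaySep G C ∈ P} := by
  refine ⟨fun C hC => hC.1, fun C hC D hD => by_contra fun h => hdec ?_⟩
  refine ⟨awaySep G D, .base hD.2, .base (hP.lower _ hC.2 _ ?_ (inv_awaySep_le_awaySep h))⟩
  exact (order_inv _).trans_lt (hP.subset hD.2)

/-- The vertex set of the component of `v` in the graph minus `X`. -/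
def componentAvoiding (G : SimpleGraph V) (X : Set V) (v : V) : Set V :=
  {w | ∃ p : G.Walk v w, ∀ x ∈ p.support, x ∉ X}

theorem mem_componentAvoiding_self {X : Set V} {v : V} (hv : v ∉ X) :
    v ∈ componentAvoiding G X v :=
  ⟨.nil, by simpa using hv⟩

theorem componentAvoiding_disjoint {X : Set V} {v w : V} (hw : w ∈ componentAvoiding G X v) :
    w ∉ X := by
  obtain ⟨p, hp⟩ := hw
  exact hp w p.end_mem_support

theorem mem_componentAvoiding_of_adj {X : Set V} {v w x : V} (hw : w ∈ componentAvoiding G X v)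
    (hwx : G.Adj w x) (hx : x ∉ X) : x ∈ componentAvoiding G X v := by
  obtain ⟨p, hp⟩ := hw
  refine ⟨p.concat hwx, fun y hy => ?_⟩
  rw [SimpleGraph.Walk.support_concat, List.mem_append,
    List.mem_singleton] at hy
  rcases hy with hy | rfl
  · exact hp y hy
  · exact hx

theorem componentAvoiding_subset_of_mem {X : Set V} {v w x : V} (hv : x ∈ componentAvoiding G X v)
    (hw : x ∈ componentAvoiding G X w) : componentAvoiding G X v ⊆ componentAvoiding G X w := by
  rintro y ⟨p, hp⟩
  obtain ⟨q, hq⟩ := hv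
  obtain ⟨r, hr⟩ := hw
  refine ⟨(r.append q.reverse).append p, fun z hz => ?_⟩
  simp only [SimpleGraph.Walk.mem_support_append_iff, SimpleGraph.Walk.support_reverse,
    List.mem_reverse] at hz
  rcases hz with (hz | hz) | hz
  exacts [hr z hz, hq z hz, hp z hz]

theorem connected_componentAvoiding {X : Set V} {v : V} (hv : v ∉ X) :
    (G.induce (componentAvoiding G X v)).Connected := by
  classical
  refine SimpleGraph.induce_connected_of_patches v (mem_componentAvoiding_self hv) ?_
  rintro w ⟨p, hp⟩
  refine ⟨{x | x ∈ p.support}, fun x hx => ?_, p.start_mem_support, p.end_mem_support,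
    p.connected_induce_support.preconnected _ _⟩
  exact ⟨p.takeUntil x hx, fun y hy => hp y (p.support_takeUntil_subset_support hx hy)⟩

theorem awaySep_componentAvoiding_inter_subset {X : Set V} {v : V} :
    (awaySep G (componentAvoiding G X v)).A ∩ (awaySep G (componentAvoiding G X v)).B ⊆ X := by
  rintro w ⟨h₁, h₂ | ⟨c, hc, hcw⟩⟩
  · exact absurd h₂ h₁
  · by_contra hw
    exact h₁ (mem_componentAvoiding_of_adj hc hcw hw)

theorem exists_bramble_of_flapSet [Finite V] {k : ℕ} (hk : 0 < k) {P : Set (VertexSep G)}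
    (hP : IsFlapSet k P) (hdec : ¬ IsDecomposing k P)
    (hor : ∀ s ∈ sepsLT G k, s ∈ P ∨ inv s ∈ P) :
    ∃ ℬ : Set (Set V), IsBramble G ℬ ∧ k ≤ brambleOrder ℬ := by
  refine ⟨_, isBramble_of_flapSet hP hdec, ?_⟩
  refine le_csInf ⟨_, _, (isBramble_of_flapSet hP hdec).covers_univ, rfl⟩ ?_
  rintro _ ⟨X, hX, rfl⟩
  by_contra! hlt
  -- Since `X` covers the bramble, no component of `G - X` belongs to it, so `P` points away from
  -- each. These separations form a star with interior inside `X`.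
  refine hdec (.of_star hk (R := (fun v => inv (awaySep G (componentAvoiding G X v))) '' Xᶜ)
    ?_ ?_ ?_)
  · rintro _ ⟨v, hv, rfl⟩
    refine (hor _ ?_).resolve_left fun h => ?_
    · exact (Set.ncard_le_ncard awaySep_componentAvoiding_inter_subset (Set.toFinite _)).trans_lt hlt
    · obtain ⟨w, hw, hw'⟩ := hX _ ⟨connected_componentAvoiding hv, h⟩
      exact componentAvoiding_disjoint hw' hw
  · rintro _ ⟨v, hv, rfl⟩ _ ⟨w, hw, rfl⟩ hne
    refine inv_awaySep_le_awaySep fun h => hne ?_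
    obtain ⟨x, hx₁, hx₂⟩ : (componentAvoiding G X w ∩ componentAvoiding G X v).Nonempty := by
      rcases h with h | ⟨c, hc, d, hd, hcd⟩
      · exact h
      · exact ⟨d, mem_componentAvoiding_of_adj hc hcd (componentAvoiding_disjoint hd), hd⟩
    exact congrArg (fun C => inv (awaySep G C)) ((componentAvoiding_subset_of_mem hx₂ hx₁).antisymm
      (componentAvoiding_subset_of_mem hx₁ hx₂))
  · refine (Set.ncard_le_ncard (fun v hv => ?_) (Set.toFinite X)).trans_lt hlt
    by_contra hvX
    have := Set.mem_iInter₂.1 hv _ ⟨v, hvX, rfl⟩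
    exact this (mem_componentAvoiding_self hvX)

end Uncrossing

/-! ### From decompositions by small separations to tree-decompositions -/

section Gluing

variable {V : Type*} {G : SimpleGraph V}

/-- Every edge remains a bridge: collapsing the other summand to an end of the edge turns a walk
avoiding it into reachability within one summand. -/
theorem isAcyclic_sum {M N : Type*} {S : SimpleGraph M} {T : SimpleGraph N} (hS : S.IsAcyclic)
    (hT : T.IsAcyclic) : (S.sum T).IsAcyclic := by
  rw [SimpleGraph.isAcyclic_iff_forall_adj_isBridge] at hS hT ⊢
  rintro (u | u) (v | v) h
  · rw [SimpleGraph.sum_adj_inl] at h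
    rw [SimpleGraph.isBridge_iff]
    have key : ∀ x y, ((S.sum T).deleteEdges {s(Sum.inl u, Sum.inl v)}).Walk x y →
        (S.deleteEdges {s(u, v)}).Reachable (Sum.elim id (fun _ => u) x)
          (Sum.elim id (fun _ => u) y) := by
      intro x y p
      induction p with
      | nil => rfl
      | @cons x y z hxy p ih =>
        refine SimpleGraph.Reachable.trans ?_ ih
        rcases x with x | x <;> rcases y with y | y <;>
          simp [SimpleGraph.deleteEdges_adj] at hxy
        · exact SimpleGraph.Adj.reachable (by simpa [SimpleGraph.deleteEdges_adj] using hxy)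
        · rfl
    rintro ⟨p⟩
    exact SimpleGraph.isBridge_iff.1 (hS h) (key _ _ p)
  · simp at h
  · simp at h
  · rw [SimpleGraph.sum_adj_inr] at h
    rw [SimpleGraph.isBridge_iff]
    have key : ∀ x y, ((S.sum T).deleteEdges {s(Sum.inr u, Sum.inr v)}).Walk x y →
        (T.deleteEdges {s(u, v)}).Reachable (Sum.elim (fun _ => u) id x)
          (Sum.elim (fun _ => u) id y) := by
      intro x y p
      induction p with
      | nil => rfl
      | @cons x y z hxy p ih =>
        refine SimpleGraph.Reachable.trans ?_ ih
        rcases x with x | x <;> rcases y with y | y <;>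
          simp [SimpleGraph.deleteEdges_adj] at hxy
        · rfl
        · exact SimpleGraph.Adj.reachable (by simpa [SimpleGraph.deleteEdges_adj] using hxy)
    rintro ⟨p⟩
    exact SimpleGraph.isBridge_iff.1 (hT h) (key _ _ p)

theorem isTree_sum_sup_edge {M N : Type*} {S : SimpleGraph M} {T : SimpleGraph N} (hS : S.IsTree)
    (hT : T.IsTree) (a : M) (b : N) :
    (S.sum T ⊔ SimpleGraph.edge (Sum.inl a) (Sum.inr b)).IsTree :=
  ⟨hS.connected.sum_sup_edge hT.connected,
    SimpleGraph.IsAcyclic.sup_edge_of_not_reachable (SimpleGraph.not_reachable_sum_inl_inr _ _)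
      (isAcyclic_sum hS.isAcyclic hT.isAcyclic)⟩

/-- `G[A]` has a tree-decomposition into parts of size less than `k`, one of which contains
`X`. -/
def HasSmallTreeDecomp (G : SimpleGraph V) (k : ℕ) (A X : Set V) : Prop :=
  ∃ (N : Type) (_ : Fintype N) (T : SimpleGraph N) (bag : N → Set V), T.IsTree ∧
    (∀ t, bag t ⊆ A) ∧ (∀ t, (bag t).ncard < k) ∧ (∀ v ∈ A, ∃ t, v ∈ bag t) ∧
    (∀ u ∈ A, ∀ v ∈ A, G.Adj u v → ∃ t, u ∈ bag t ∧ v ∈ bag t) ∧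
    (∀ v t t', v ∈ bag t → v ∈ bag t' → ∃ p : T.Walk t t', ∀ s ∈ p.support, v ∈ bag s) ∧
    ∃ t, X ⊆ bag t

theorem HasSmallTreeDecomp.of_ncard_lt {k : ℕ} {A : Set V} (h : A.ncard < k) :
    HasSmallTreeDecomp G k A A :=
  ⟨Unit, inferInstance, ⊥, fun _ => A, SimpleGraph.IsTree.of_subsingleton, fun _ => subset_rfl,
    fun _ => h, fun _ hv => ⟨(), hv⟩, fun _ hu _ hv _ => ⟨(), hu, hv⟩,
    fun _ _ _ hv _ => ⟨.nil, fun _ _ => hv⟩, (), subset_rfl⟩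

theorem HasSmallTreeDecomp.mono_right {k : ℕ} {A X Y : Set V} (h : HasSmallTreeDecomp G k A X)
    (hYX : Y ⊆ X) : HasSmallTreeDecomp G k A Y := by
  obtain ⟨N, i, T, bag, h₁, h₂, h₃, h₄, h₅, h₆, t, ht⟩ := h
  exact ⟨N, i, T, bag, h₁, h₂, h₃, h₄, h₅, h₆, t, hYX.trans ht⟩

/-- The two trees are joined by an edge between the nodes whose parts contain `X` and `Y`. Both
parts contain `A ∩ B`, so a common vertex can be followed across the new edge. -/
theorem HasSmallTreeDecomp.glue {k : ℕ} {A B X Y : Set V} (hA : HasSmallTreeDecomp G k A X)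
    (hB : HasSmallTreeDecomp G k B Y) (hX : A ∩ B ⊆ X) (hY : A ∩ B ⊆ Y)
    (hadj : ∀ a ∈ A \ B, ∀ b ∈ B \ A, ¬ G.Adj a b) : HasSmallTreeDecomp G k (A ∪ B) X := by
  obtain ⟨M, _, S, bag, hS, hsub, hcard, hcov, hedge, hconn, s, hs⟩ := hA
  obtain ⟨N, _, T, bag', hT, hsub', hcard', hcov', hedge', hconn', t, ht⟩ := hB
  let U := S.sum T ⊔ SimpleGraph.edge (Sum.inl s) (Sum.inr t)
  let f : S →g U := ⟨Sum.inl, fun h => Or.inl (SimpleGraph.sum_adj_inl.2 h)⟩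
  let g : T →g U := ⟨Sum.inr, fun h => Or.inl (SimpleGraph.sum_adj_inr.2 h)⟩
  have hst : U.Adj (Sum.inl s) (Sum.inr t) := .inr (by simp [SimpleGraph.edge_adj])
  have cross : ∀ v a b, v ∈ bag a → v ∈ bag' b → ∃ p : U.Walk (Sum.inl a) (Sum.inr b),
      ∀ c ∈ p.support, v ∈ Sum.elim bag bag' c := by
    intro v a b ha hb
    obtain ⟨p, hp⟩ := hconn v a s ha (hs (hX ⟨hsub a ha, hsub' b hb⟩))
    obtain ⟨q, hq⟩ := hconn' v t b (ht (hY ⟨hsub a ha, hsub' b hb⟩)) hb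
    refine ⟨(p.map f).append (.cons hst (q.map g)), fun c hc => ?_⟩
    simp only [SimpleGraph.Walk.mem_support_append_iff, SimpleGraph.Walk.support_cons,
      SimpleGraph.Walk.support_map, List.mem_cons, List.mem_map] at hc
    rcases hc with ⟨d, hd, rfl⟩ | rfl | ⟨d, hd, rfl⟩
    · exact hp d hd
    · exact hp s p.end_mem_support
    · exact hq d hd
  refine ⟨M ⊕ N, inferInstance, U, Sum.elim bag bag', isTree_sum_sup_edge hS hT s t, ?_, ?_, ?_,
    ?_, ?_, .inl s, hs⟩
  · rintro (a | b)
    exacts [(hsub a).trans Set.subset_union_left, (hsub' b).trans Set.subset_union_right]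
  · rintro (a | b)
    exacts [hcard a, hcard' b]
  · rintro v (hv | hv)
    · exact (hcov v hv).imp' Sum.inl fun _ => id
    · exact (hcov' v hv).imp' Sum.inr fun _ => id
  · have hA : ∀ u ∈ A, ∀ v ∈ A, G.Adj u v →
        ∃ c, u ∈ Sum.elim bag bag' c ∧ v ∈ Sum.elim bag bag' c :=
      fun u hu v hv h => (hedge u hu v hv h).imp' Sum.inl fun _ => id
    have hB : ∀ u ∈ B, ∀ v ∈ B, G.Adj u v →
        ∃ c, u ∈ Sum.elim bag bag' c ∧ v ∈ Sum.elim bag bag' c :=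
      fun u hu v hv h => (hedge' u hu v hv h).imp' Sum.inr fun _ => id
    intro u hu v hv huv
    by_cases h₁ : u ∈ A ∧ v ∈ A
    · exact hA u h₁.1 v h₁.2 huv
    by_cases h₂ : u ∈ B ∧ v ∈ B
    · exact hB u h₂.1 v h₂.2 huv
    exfalso
    rcases hu with hu | hu <;> rcases hv with hv | hv
    · exact h₁ ⟨hu, hv⟩
    · exact hadj u ⟨hu, fun h => h₂ ⟨h, hv⟩⟩ v ⟨hv, fun h => h₁ ⟨hu, h⟩⟩ huv
    · exact hadj v ⟨hv, fun h => h₂ ⟨hu, h⟩⟩ u ⟨hu, fun h => h₁ ⟨h, hv⟩⟩ huv.symm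
    · exact h₂ ⟨hu, hv⟩
  · rintro v (a | a) (b | b) ha hb
    · obtain ⟨p, hp⟩ := hconn v a b ha hb
      refine ⟨p.map f, fun c hc => ?_⟩
      rw [SimpleGraph.Walk.support_map, List.mem_map] at hc
      obtain ⟨d, hd, rfl⟩ := hc
      exact hp d hd
    · exact cross v a b ha hb
    · obtain ⟨p, hp⟩ := cross v b a hb ha
      exact ⟨p.reverse, fun c hc => hp c (by simpa using hc)⟩
    · obtain ⟨p, hp⟩ := hconn' v a b ha hb
      refine ⟨p.map g, fun c hc => ?_⟩
      rw [SimpleGraph.Walk.support_map, List.mem_map] at hc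
      obtain ⟨d, hd, rfl⟩ := hc
      exact hp d hd

/-- Tree-decompositions of the first sides of a star are glued to a part containing its
interior. -/
theorem HasSmallTreeDecomp.glue_star {k : ℕ} {Z : Set V} (hZ : Z.ncard < k)
    {R : Set (VertexSep G)} (hfin : R.Finite)
    (hR : ∀ r ∈ R, HasSmallTreeDecomp G k r.A (r.A ∩ r.B))
    (hstar : ∀ r ∈ R, ∀ s ∈ R, r ≠ s → r ≤ inv s) (hZB : ∀ r ∈ R, Z ⊆ r.B)
    (hZA : ∀ r ∈ R, r.A ∩ r.B ⊆ Z) : HasSmallTreeDecomp G k (Z ∪ ⋃ r ∈ R, r.A) Z := by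
  induction R, hfin using Set.Finite.induction_on with
  | empty => simpa using HasSmallTreeDecomp.of_ncard_lt hZ
  | @insert r R hr _ ih =>
    have ih := ih (fun t ht => hR t (.inr ht)) (fun t ht t' ht' => hstar t (.inr ht) t' (.inr ht'))
      (fun t ht => hZB t (.inr ht)) (fun t ht => hZA t (.inr ht))
    -- All that is glued so far lies beyond `r`, so it meets `r.A` only in the separator of `r`,
    -- which is contained in `Z`.
    have hB : Z ∪ ⋃ t ∈ R, t.A ⊆ r.B := by
      refine Set.union_subset (hZB r (.inl rfl)) (Set.iUnion₂_subset fun t ht => ?_)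
      exact (hstar t (.inr ht) r (.inl rfl) fun h => hr (h ▸ ht)).1
    have hAB : r.A ∩ r.B ⊆ Z := hZA r (.inl rfl)
    have hmeet : (Z ∪ ⋃ t ∈ R, t.A) ∩ r.A ⊆ r.A ∩ r.B := fun v hv => ⟨hv.2, hB hv.1⟩
    have := ih.glue (hR r (.inl rfl)) (hmeet.trans hAB) hmeet ?_
    · rwa [Set.biUnion_insert, Set.union_comm r.A, ← Set.union_assoc]
    · rintro a ⟨ha, ha'⟩ b ⟨hb, hb'⟩ hab
      exact r.not_adj b ⟨hb, fun h => hb' (.inl (hAB ⟨hb, h⟩))⟩ a ⟨hB ha, ha'⟩ hab.symm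

theorem Decomp.hasSmallTreeDecomp [Finite V] {k : ℕ} {u : VertexSep G}
    (h : Decomp k {s | s ∈ sepsLT G k ∧ s ≤ inv s} u) :
    HasSmallTreeDecomp G k u.A (u.A ∩ u.B) := by
  induction h with
  | base hu =>
    -- A small separation has `A ⊆ B`, so `A` is its separator and fits into one part.
    have h := Set.inter_eq_left.2 hu.2.1
    have hlt := hu.1
    rw [sepsLT, Set.mem_ofPred_eq, VertexSep.order] at hlt
    change _ ∩ _ = _ at h
    rw [VertexSep.inv_A] at h
    rw [h] at hlt ⊢
    exact .of_ncard_lt hlt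
  | @step u R _ hle hstar hcard ih =>
    have := HasSmallTreeDecomp.glue_star hcard (Set.toFinite R) ih hstar
      (fun r hr v hv => Set.mem_iInter₂.1 hv.2 r hr) ?_
    · have hA : (u.A ∩ ⋂ r ∈ R, r.B) ∪ ⋃ r ∈ R, r.A = u.A := by
        refine subset_antisymm (Set.union_subset Set.inter_subset_left
          (Set.iUnion₂_subset fun r hr => (hle r hr).1)) fun v hv => ?_
        by_cases h : v ∈ ⋂ r ∈ R, r.B
        · exact .inl ⟨hv, h⟩
        · simp only [Set.mem_iInter, not_forall] at h
          obtain ⟨r, hr, hvr⟩ := h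
          exact .inr (Set.mem_iUnion₂.2 ⟨r, hr, r.mem_A_of_notMem_B hvr⟩)
      rw [hA] at this
      exact this.mono_right (Set.inter_subset_inter_right _
        (Set.subset_iInter₂ fun r hr => (hle r hr).2))
    · refine fun r hr v hv => ⟨(hle r hr).1 hv.1, Set.mem_iInter₂.2 fun s hs => ?_⟩
      by_cases h : r = s
      · exact h ▸ hv.2
      · exact (hstar r hr s hs h).1 hv.1

theorem HasSmallTreeDecomp.treeWidth_lt {k : ℕ} {X : Set V}
    (h : HasSmallTreeDecomp G k Set.univ X) (hk : 0 < k) : treeWidth G < k - 1 := by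
  classical
  obtain ⟨N, hN, T, bag, hT, -, hcard, hcov, hedge, hconn, -⟩ := h
  let D : TreeDecomposition G T :=
    { isTree := hT
      bag := bag
      exists_mem_bag := fun v => hcov v trivial
      exists_edge_bag := fun u v huv => hedge u trivial v trivial huv
      inter_subset := by
        rintro t₁ t₂ t₃ p hp ht₂ v ⟨h₁, h₃⟩
        obtain ⟨q, hq⟩ := hconn v t₁ t₃ h₁ h₃
        have : p = q.bypass :=
          (hT.existsUnique_path t₁ t₃).unique hp q.bypass_isPath
        exact hq t₂ (q.support_bypass_subset_support (this ▸ ht₂)) }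
  refine (csInf_le (bddBelow_widths G) ⟨N, hN, T, D, rfl⟩).trans_lt ?_
  have : (Finset.univ.sup fun t => (D.bag t).ncard) < k :=
    (Finset.sup_lt_iff hk).2 fun t _ => hcard t
  simp only [TreeDecomposition.width]
  omega

theorem IsDecomposing.treeWidth_lt [Finite V] {k : ℕ} (hk : 0 < k)
    (h : IsDecomposing k {s : VertexSep G | s ∈ sepsLT G k ∧ s ≤ inv s}) :
    treeWidth G < k - 1 := by
  obtain ⟨r, h₁, h₂⟩ := h
  have := h₁.hasSmallTreeDecomp.glue h₂.hasSmallTreeDecomp subset_rfl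
    (Set.inter_comm _ _).subset r.not_adj
  rw [VertexSep.inv_A, r.union_eq] at this
  exact this.treeWidth_lt hk

theorem isFlapSet_small (G : SimpleGraph V) (k : ℕ) :
    IsFlapSet k {s : VertexSep G | s ∈ sepsLT G k ∧ s ≤ inv s} where
  subset _ hs := hs.1
  lower _ hp _ hq hqp := ⟨hq, hqp.trans (hp.2.trans ((inv_le_inv_iff _ _).2 hqp))⟩
  small _ hu h := ⟨hu, h⟩

/-- The hard direction of the tree-width duality theorem. -/
theorem exists_bramble_of_le_treeWidth [Finite V] {k : ℕ} (hk : 0 < k)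
    (h : (k : ℤ) - 1 ≤ treeWidth G) :
    ∃ ℬ : Set (Set V), IsBramble G ℬ ∧ k ≤ brambleOrder ℬ := by
  obtain ⟨P, hP, hdec, hor⟩ :=
    (isFlapSet_small G k).exists_maximal fun h' => (h'.treeWidth_lt hk).not_ge h
  exact exists_bramble_of_flapSet hk hP hdec hor

end Gluing

/-! ### From brambles to tangles, and from tangles to the absence of trees -/

section Tangles

variable {V : Type*} {G : SimpleGraph V}

theorem disjoint_side_of_connected {C : Set V} (hC : (G.induce C).Connected) (s : VertexSep G)
    (h : ∀ v ∈ C, v ∈ s.A → v ∉ s.B) : (∀ v ∈ C, v ∉ s.A) ∨ ∀ v ∈ C, v ∉ s.B := by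
  have key : ∀ a b : C, (G.induce C).Walk a b → a.1 ∈ s.A → b.1 ∈ s.A := by
    intro a b p
    induction p with
    | nil => exact id
    | @cons a b c hab p ih =>
      refine fun ha => ih (by_contra fun hb => ?_)
      exact s.not_adj a ⟨ha, h _ a.2 ha⟩ b ⟨s.mem_B_of_notMem_A hb, hb⟩ hab
  by_contra! hcon
  obtain ⟨⟨a, ha, haA⟩, b, hb, hbB⟩ := hcon
  obtain ⟨p⟩ := hC.preconnected ⟨a, ha⟩ ⟨b, hb⟩
  exact h b hb (key _ _ p haA) hbB

theorem exists_tangle_of_bramble [Finite V] {k : ℕ} {ℬ : Set (Set V)} (hℬ : IsBramble G ℬ)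
    (hk : k ≤ brambleOrder ℬ) :
    ∃ O : Set (VertexSep G), IsTangle (sepsLT G k) (forbiddenStars G k) O := by
  have havoid : ∀ X : Set V, X.ncard < k → ∃ C ∈ ℬ, ∀ v ∈ C, v ∉ X := by
    intro X hX
    by_contra! hcon
    refine hX.not_ge (hk.trans (Nat.sInf_le ⟨X, fun C hC => ?_, rfl⟩))
    obtain ⟨v, hv, hvX⟩ := hcon C hC
    exact ⟨v, hvX, hv⟩
  let O : Set (VertexSep G) := {s | s ∈ sepsLT G k ∧ ∃ C ∈ ℬ, ∀ v ∈ C, v ∉ s.A}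
  have hinv : ∀ s ∈ sepsLT G k, inv s ∈ sepsLT G k := fun s hs => (s.order_inv).trans_lt hs
  have hor : ∀ s ∈ sepsLT G k, s ∈ O ∨ inv s ∈ O := by
    intro s hs
    obtain ⟨C, hC, hCX⟩ := havoid _ hs
    exact (disjoint_side_of_connected (hℬ.1 C hC) s fun v hv hA hB => hCX v hv ⟨hA, hB⟩).imp
      (fun h => ⟨hs, C, hC, h⟩) fun h => ⟨hinv s hs, C, hC, h⟩
  have hexcl : ∀ s, s ∈ O → inv s ∉ O := by
    rintro s ⟨-, C, hC, hCA⟩ ⟨-, D, hD, hDB⟩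
    rcases hℬ.2 C hC D hD with ⟨v, hvC, hvD⟩ | ⟨c, hc, d, hd, hcd⟩
    · exact hDB v hvD (s.mem_B_of_notMem_A (hCA v hvC))
    · exact s.not_adj d ⟨s.mem_A_of_notMem_B (hDB d hd), hDB d hd⟩ c
        ⟨s.mem_B_of_notMem_A (hCA c hc), hCA c hc⟩ hcd.symm
  refine ⟨O, ⟨fun s hs => hs.1, fun s hs => ?_⟩, ?_, ?_⟩
  · rcases hor s hs with h | h
    · refine ⟨s, ⟨.inl rfl, h⟩, ?_⟩
      rintro _ ⟨rfl | rfl, hx⟩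
      · rfl
      · exact absurd hx (hexcl s h)
    · refine ⟨inv s, ⟨.inr rfl, h⟩, ?_⟩
      rintro _ ⟨rfl | rfl, hx⟩
      · exact absurd h (hexcl _ hx)
      · rfl
  · rintro r hr s - - hrs ⟨hr', -, C, hC, hCA⟩
    exact hexcl r ⟨hr, C, hC, fun v hv hvA => hCA v hv (hrs.le.1 hvA)⟩ hr'
  · rintro σ hσ ⟨-, hstar, hcard⟩
    obtain ⟨C, hC, hCX⟩ := havoid _ hcard
    obtain ⟨c⟩ := (hℬ.1 C hC).nonempty
    have := hCX c.1 c.2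
    simp only [Set.mem_iInter, not_forall] at this
    obtain ⟨s, hs, hcs⟩ := this
    -- The separator of `s` lies in the interior of the star, which `C` avoids. As `C` has a vertex
    -- outside `s.B`, it misses `s.B` altogether, against the choice of `s` in `O`.
    refine hexcl s (hσ hs) ⟨hinv s (hσ hs).1, C, hC, ?_⟩
    refine (disjoint_side_of_connected (hℬ.1 C hC) s fun v hv hA hB => hCX v hv ?_).resolve_left
      fun h => h c.1 c.2 (s.mem_A_of_notMem_B hcs)
    refine Set.mem_iInter₂.2 fun t ht => ?_
    by_cases h : s = t
    · exact h ▸ hB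
    · exact (hstar.2 s hs t ht h).1 hA

theorem IsTangle.not_hasSepTreeOver {U : Type*} [SeparationSystem U] {S : Set U} {F : Set (Set U)}
    {O : Set U} (h : IsTangle S F O) : ¬ HasSepTreeOver S F := by
  classical
  rintro ⟨N, _, T, τ, hτ⟩
  have hex : ∀ t : N, ∃ e : T.Dart, e.snd = t ∧ τ.α e ∉ O := by
    intro t
    by_contra! hcon
    refine h.2.2 _ ?_ (hτ t)
    rintro _ ⟨e, he, rfl⟩
    exact hcon e he
  choose e he heO using hex
  -- Each node selects an incoming edge whose separation is not in `O`. With one edge fewer than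
  -- nodes, some edge is selected from both ends, so `O` contains neither of its orientations.
  obtain ⟨t, -, t', -, hne, heq⟩ := Finset.exists_ne_map_eq_of_card_lt_of_maps_to
    (s := Finset.univ) (t := T.edgeFinset) (f := fun t => (e t).edge)
    (by have := τ.isTree.card_edgeFinset; rw [Finset.card_univ]; omega)
    (fun t _ => by simp)
  rcases (SimpleGraph.dart_edge_eq_iff _ _).1 heq with h' | h'
  · exact hne (by rw [← he t, ← he t', h'])
  · obtain ⟨x, ⟨hx | hx, hxO⟩, -⟩ := h.1.2 _ (τ.mem (e t'))
    · exact heO t' (hx ▸ hxO)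
    · refine heO t ?_
      rw [h', τ.map_symm]
      exact hx ▸ hxO

end Tangles

/-! ### The two sides of an edge of a tree -/

section TreeSides

variable {N : Type*} {T : SimpleGraph N}

/-- The nodes on the side of `x` of the edge between `x` and `y`. -/
def treeSide (T : SimpleGraph N) (x y : N) : Set N :=
  {n | (T.deleteEdges {s(x, y)}).Reachable n x}

theorem mem_treeSide_or (hT : T.Connected) (x y n : N) :
    n ∈ treeSide T x y ∨ n ∈ treeSide T y x := by
  obtain ⟨p⟩ := hT.preconnected n x
  induction p with
  | nil => exact .inl .rfl
  | @cons a b c hab p ih =>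
    by_cases h : s(a, b) = s(c, y)
    · rcases Sym2.eq_iff.1 h with ⟨rfl, -⟩ | ⟨rfl, -⟩
      · exact .inl .rfl
      · exact .inr .rfl
    · have h' : s(a, b) ≠ s(y, c) := by rwa [Sym2.eq_swap (a := y)]
      refine ih.imp (fun hb => ?_) fun hb => ?_
      · exact .trans (SimpleGraph.Adj.reachable (SimpleGraph.deleteEdges_adj.2 ⟨hab, h⟩)) hb
      · exact .trans (SimpleGraph.Adj.reachable (SimpleGraph.deleteEdges_adj.2 ⟨hab, h'⟩)) hb

theorem notMem_treeSide (hT : T.IsAcyclic) {x y : N} (hxy : T.Adj x y) : y ∉ treeSide T x y :=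
  fun h => SimpleGraph.isBridge_iff.1
    (SimpleGraph.isAcyclic_iff_forall_adj_isBridge.1 hT hxy) h.symm

theorem mem_support_of_mem_treeSide (hT : T.IsAcyclic) {x y n m : N} (hxy : T.Adj x y)
    (hn : n ∈ treeSide T x y) (hm : m ∈ treeSide T y x) (p : T.Walk n m) :
    x ∈ p.support ∧ y ∈ p.support := by
  have hmem : s(x, y) ∈ p.edges := by
    refine SimpleGraph.Walk.mem_edges_of_not_reachable_deleteEdges p fun h => ?_
    rw [treeSide, Sym2.eq_swap] at hm
    exact notMem_treeSide hT hxy (hm.symm.trans (h.symm.trans hn))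
  exact ⟨p.fst_mem_support_of_mem_edges hmem, p.snd_mem_support_of_mem_edges hmem⟩

/-- A walk to `x` that avoids the edge `xt` never visits `t`, so it also avoids `tx'`; the edge `xt`
then extends it to `t`. -/
theorem treeSide_subset (hT : T.IsAcyclic) {x x' t : N} (hx : T.Adj x t) (hne : x ≠ x') :
    treeSide T x t ⊆ treeSide T t x' := by
  have key : ∀ n z, (T.deleteEdges {s(x, t)}).Walk n z → z = x →
      (T.deleteEdges {s(t, x')}).Reachable n z := by
    intro n z p
    induction p with
    | nil => exact fun _ => .rfl
    | @cons a b c hab p ih =>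
      rintro rfl
      have hb : b ≠ t := by rintro rfl; exact notMem_treeSide hT hx ⟨p⟩
      have ha : a ≠ t := by rintro rfl; exact notMem_treeSide hT hx ⟨.cons hab p⟩
      refine .trans (SimpleGraph.Adj.reachable (SimpleGraph.deleteEdges_adj.2 ⟨hab.1, fun h => ?_⟩))
        (ih rfl)
      rcases Sym2.eq_iff.1 h with ⟨h, -⟩ | ⟨-, h⟩
      exacts [ha h, hb h]
  rintro n ⟨p⟩
  refine (key n x p rfl).trans (SimpleGraph.Adj.reachable
    (SimpleGraph.deleteEdges_adj.2 ⟨hx, fun h => ?_⟩))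
  rcases Sym2.eq_iff.1 h with ⟨h, -⟩ | ⟨h, -⟩
  exacts [hx.ne h, hne h]

theorem exists_mem_treeSide (hT : T.Connected) {t n : N} (hne : n ≠ t) :
    ∃ x, T.Adj x t ∧ n ∈ treeSide T x t := by
  obtain ⟨p, hp⟩ := hT.exists_isPath t n
  cases p with
  | nil => exact absurd rfl hne
  | @cons _ x _ h q =>
    rw [SimpleGraph.Walk.cons_isPath_iff] at hp
    refine ⟨x, h.symm, ⟨(q.toDeleteEdges {s(x, t)} fun e he he' => hp.2 ?_).reverse⟩⟩
    rw [Set.mem_singleton_iff.1 he'] at he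
    exact q.snd_mem_support_of_mem_edges he

end TreeSides

/-! ### From tree-decompositions to `S_k`-trees -/

section SepTrees

variable {V : Type*} {G : SimpleGraph V}

/-- The separation of `G` associated with an edge of the decomposition tree. -/
def TreeDecomposition.sep {N : Type*} {T : SimpleGraph N} (D : TreeDecomposition G T) (x y : N) :
    VertexSep G where
  A := ⋃ n ∈ treeSide T x y, D.bag n
  B := ⋃ n ∈ treeSide T y x, D.bag n
  union_eq := by
    refine Set.eq_univ_of_forall fun v => ?_
    obtain ⟨n, hn⟩ := D.exists_mem_bag v
    exact (mem_treeSide_or D.isTree.connected x y n).imp (fun h => Set.mem_biUnion h hn)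
      fun h => Set.mem_biUnion h hn
  not_adj := by
    rintro a ⟨-, ha⟩ b ⟨-, hb⟩ hab
    obtain ⟨n, hna, hnb⟩ := D.exists_edge_bag a b hab
    rcases mem_treeSide_or D.isTree.connected x y n with h | h
    exacts [hb (Set.mem_biUnion h hnb), ha (Set.mem_biUnion h hna)]

theorem TreeDecomposition.sep_inter_subset {N : Type*} {T : SimpleGraph N}
    (D : TreeDecomposition G T) {x y : N} (h : T.Adj x y) :
    (D.sep x y).A ∩ (D.sep x y).B ⊆ D.bag y := by
  rintro v ⟨hA, hB⟩
  obtain ⟨n, hn, hvn⟩ := Set.mem_iUnion₂.1 hA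
  obtain ⟨m, hm, hvm⟩ := Set.mem_iUnion₂.1 hB
  obtain ⟨p, hp⟩ := D.isTree.connected.exists_isPath n m
  exact D.inter_subset n y m p hp
    (mem_support_of_mem_treeSide D.isTree.isAcyclic h hn hm p).2 ⟨hvn, hvm⟩

theorem TreeDecomposition.sep_le_inv_sep {N : Type*} {T : SimpleGraph N}
    (D : TreeDecomposition G T) {x x' t : N} (h : T.Adj x t) (h' : T.Adj x' t) (hne : x ≠ x') :
    D.sep x t ≤ inv (D.sep x' t) :=
  ⟨Set.biUnion_subset_biUnion_left (treeSide_subset D.isTree.isAcyclic h hne),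
    Set.biUnion_subset_biUnion_left (treeSide_subset D.isTree.isAcyclic h' hne.symm)⟩

theorem TreeDecomposition.hasSepTreeOver [Finite V] {N : Type} [Fintype N] [Nontrivial N]
    {T : SimpleGraph N} (D : TreeDecomposition G T) {k : ℕ} (hD : ∀ t, (D.bag t).ncard < k) :
    HasSepTreeOver (sepsLT G k) (forbiddenStars G k) := by
  have hmem : ∀ e : T.Dart, D.sep e.fst e.snd ∈ sepsLT G k := fun e =>
    (Set.ncard_le_ncard (D.sep_inter_subset e.adj) (Set.toFinite _)).trans_lt (hD _)
  have hnbr : ∀ t, ∃ x, T.Adj x t := fun t => by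
    obtain ⟨n, hn⟩ := exists_ne t
    exact (exists_mem_treeSide D.isTree.connected hn).imp fun _ => And.left
  let τ : SepTree (sepsLT G k) T :=
    { isTree := D.isTree
      exists_edge := by
        obtain ⟨t⟩ := D.isTree.connected.nonempty
        obtain ⟨x, hx⟩ := hnbr t
        exact ⟨x, t, hx⟩
      α := fun e => D.sep e.fst e.snd
      mem := hmem
      map_symm := fun _ => rfl }
  refine ⟨N, inferInstance, T, τ, fun t => ⟨?_, ⟨?_, ?_⟩, ?_⟩⟩
  · rintro _ ⟨e, -, rfl⟩
    exact hmem e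
  · obtain ⟨x, hx⟩ := hnbr t
    exact ⟨_, ⟨(x, t), hx⟩, rfl, rfl⟩
  · rintro _ ⟨⟨⟨x, y⟩, hx⟩, rfl, rfl⟩ _ ⟨⟨⟨x', y'⟩, hx'⟩, hy, rfl⟩ hne
    obtain rfl : y' = y := hy
    exact D.sep_le_inv_sep hx hx' fun h => hne (by subst h; rfl)
  -- The interior of the star at `t` lies in the part at `t`: a vertex of another part is on the far
  -- side of some edge at `t`, hence in the separator of that edge.
  · refine (Set.ncard_le_ncard (fun v hv => ?_) (Set.toFinite _)).trans_lt (hD t)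
    obtain ⟨n, hn⟩ := D.exists_mem_bag v
    by_cases hnt : n = t
    · exact hnt ▸ hn
    obtain ⟨x, hx, hnx⟩ := exists_mem_treeSide D.isTree.connected hnt
    exact D.sep_inter_subset hx ⟨Set.mem_biUnion hnx hn,
      Set.mem_iInter₂.1 hv _ ⟨⟨(x, t), hx⟩, rfl, rfl⟩⟩

theorem hasSepTreeOver_of_card_lt {k : ℕ} (h : (Set.univ : Set V).ncard < k) :
    HasSepTreeOver (sepsLT G k) (forbiddenStars G k) := by
  -- A one-node tree has no edge, so this case needs a new tree: a single edge labelled `(V, V)`,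
  -- which is its own inverse.
  let s : VertexSep G := ⟨Set.univ, Set.univ, Set.union_self _, by simp⟩
  have hs : s ∈ sepsLT G k := by simpa [sepsLT, VertexSep.order, s] using h
  have hT : (⊤ : SimpleGraph Bool).IsTree :=
    ⟨SimpleGraph.connected_top, .of_card_le_two (by simp)⟩
  refine ⟨Bool, inferInstance, ⊤, ⟨hT, ⟨true, false, by simp⟩, fun _ => s, fun _ => hs,
    fun _ => rfl⟩, fun t => ?_⟩
  have hne : {e : (⊤ : SimpleGraph Bool).Dart | e.snd = t}.Nonempty :=
    ⟨⟨(!t, t), by simp⟩, rfl⟩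
  rw [SepTree.α, hne.image_const]
  refine ⟨by simpa using hs, ⟨Set.singleton_nonempty _, ?_⟩, by simpa [s] using h⟩
  rintro _ rfl _ rfl hne
  exact absurd rfl hne

theorem hasSepTreeOver_of_treeWidth_lt [Finite V] {k : ℕ} (h : treeWidth G < k - 1) :
    HasSepTreeOver (sepsLT G k) (forbiddenStars G k) := by
  obtain ⟨N, _, T, D, hD⟩ := Int.csInf_mem (nonempty_widths G) (bddBelow_widths G)
  have hbag : ∀ t, (D.bag t).ncard < k := by
    intro t
    have h₁ : D.width < k - 1 := hD.trans_lt h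
    have h₂ := Finset.le_sup (f := fun t => (D.bag t).ncard) (Finset.mem_univ t)
    simp only [TreeDecomposition.width] at h₁
    omega
  rcases subsingleton_or_nontrivial N with hN | hN
  · obtain ⟨t⟩ := D.isTree.connected.nonempty
    refine hasSepTreeOver_of_card_lt ((Set.ncard_le_ncard ?_ (Set.toFinite _)).trans_lt (hbag t))
    intro v _
    obtain ⟨n, hn⟩ := D.exists_mem_bag v
    exact Subsingleton.elim n t ▸ hn
  · exact D.hasSepTreeOver hbag

end SepTrees

end TangleDuality

theorem mainTheorem3 {V : Type*} [Finite V] [Nonempty V] (G : SimpleGraph V)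
    (k : ℕ) (hk : 0 < k) :
    List.TFAE [
      ∃ ℬ : Set (Set V), TangleDuality.IsBramble G ℬ ∧ k ≤ TangleDuality.brambleOrder ℬ,
      ∃ O : Set (TangleDuality.VertexSep G),
        TangleDuality.IsTangle (TangleDuality.sepsLT G k) (TangleDuality.forbiddenStars G k) O,
      ¬ TangleDuality.HasSepTreeOver (TangleDuality.sepsLT G k)
        (TangleDuality.forbiddenStars G k),
      (k : ℤ) - 1 ≤ TangleDuality.treeWidth G] := by
  tfae_have 1 → 2 := fun ⟨_, hℬ, h⟩ => TangleDuality.exists_tangle_of_bramble hℬ h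
  tfae_have 2 → 3 := fun ⟨_, hO⟩ => hO.not_hasSepTreeOver
  tfae_have 3 → 4 := fun h => not_lt.1 fun h' =>
    h (TangleDuality.hasSepTreeOver_of_treeWidth_lt h')
  tfae_have 4 → 1 := TangleDuality.exists_bramble_of_le_treeWidth hk
  tfae_finish
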